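/- $\mathrm{PH}^{cc} \subseteq \mathrm{BP}\cdot\mathrm{PP}^{cc}$, where the notions are as follows. A language is a set $L$ of pairs $(x,y)$ of binary strings of equal length, and $L_n$ is its $n$-bit section, the set of the pairs $(x,y)\in L$ with $|x|=|y|=n$. A communication complexity class is a set of languages. All logarithms are to base $2$ (with $\log 0 := 0$ where $n=0$ occurs). We write $h(n)\le\mathrm{polylog}(n)$ if there is a constant $c\in\mathbb N$ with $h(n)\le c(\log n)^c+c$ for all $n$. A deterministic protocol over $X\times Y$ is a binary tree whose inner nodes each belong to one of the two players, who sends one bit depending on their own input, and whose leaves carry an output in $\{0,1\}$; its cost is the height of the tree. A guess protocol is a sequence $\Pi=(\Pi_1,\dots,\Pi_l)$, $l\ge 1$, of deterministic protocols; its cost is $\lceil\log l\rceil+\max_i \mathrm{cost}(\Pi_i)$. It computes $f$ in PP mode if, for all $(x,y)$, $f(x,y)=1$ holds exactly when more of the $\Pi_i$ output $1$ than output $0$ on $(x,y)$. $\mathrm{PP}(f)$ is the minimum cost of a guess protocol that computes $f$ in PP mode, and $\mathrm{PP}^{cc}$ is the class of all languages $L$ with $\mathrm{PP}(L_n)\le\mathrm{polylog}(n)$.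 Let $\langle x,r\rangle$ be the injective pairing of binary strings that doubles each bit of $x$ and then appends $01$ and $r$. For a class $\mathcal C$, a language $L$ is in $\mathrm{BP}\cdot\mathcal C$ if there are a language $L'\in\mathcal C$ and a polynomially bounded function $q:[0,\infty)\to[0,\infty)$ (that is, $q(t)\le ct^c+c$ for some constant $c\in\mathbb N$) such that for every $n$ and all $n$-bit strings $x,y$, with $m=\lceil q(\log n)\rceil$, $$(x,y)\notin L\implies 2^{-m}\,\bigl|\{r\in\{0,1\}^m : (\langle x,r\rangle,\langle y,r\rangle)\in L'\}\bigr|\le \tfrac13,$$ $$(x,y)\in L\implies 2^{-m}\,\bigl|\{r\in\{0,1\}^m : (\langle x,r\rangle,\langle y,r\rangle)\in L'\}\bigr|\ge \tfrac23 .$$ For $k\ge1$, a language $L$ is in $\Sigma_k^{cc}$ if there are functions $\ell_1,\dots,\ell_k:\mathbb N\to\mathbb N$ with $\ell_i(n)\le\mathrm{polylog}(n)$ and, for each $n$, Boolean functions $\varphi_n,\psi_n$ on $\{0,1\}^n\times\{0,1\}^{\ell_1(n)+\dots+\ell_k(n)}$ such that for all $n$ and all $n$-bit strings $x,y$ $$(x,y)\in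 L\iff \exists u_1\,\forall u_2\,\exists u_3\cdots Q_k u_k:\ \varphi_n(x,u_1\cdots u_k)\mathbin{\diamond}\psi_n(y,u_1\cdots u_k),$$ where $u_i$ ranges over $\{0,1\}^{\ell_i(n)}$, the quantifiers alternate, and $\diamond$ is $\wedge$ for odd $k$ and $\vee$ for even $k$. Finally, $\mathrm{PH}^{cc}=\bigcup_{k\ge1}\Sigma_k^{cc}$. -/

import Mathlib

namespace CommCC

/-! ### Languages -/

/-- The set `B**` of pairs of binary strings of equal length. -/
abbrev EqLenPair : Type := {p : List Bool × List Bool // p.1.length = p.2.length}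

/-- A (formal) language is a subset of `B**`. -/
abbrev CCLanguage : Type := Set EqLenPair

/-- The words of exactly `n` bits. -/
abbrev Word (n : ℕ) : Type := List.Vector Bool n

/-- The `n`-bit section of a language, as a predicate on pairs of `n`-bit words. -/
def CCLanguage.nsection (L : CCLanguage) (n : ℕ) (x y : Word n) : Prop :=
  (⟨(x.toList, y.toList), by simp⟩ : EqLenPair) ∈ L

/-- `f n ≤ polylog(n)`.  The additive constant takes care of `n = 1`, where `log n = 0`. -/
def IsPolylog (f : ℕ → ℕ) : Prop :=
  ∃ c : ℕ, ∀ n : ℕ, (f n : ℝ) ≤ c * Real.logb 2 n ^ c + c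

/-! ### Deterministic protocols -/

/-- A deterministic two-party protocol over the domain `X × Y` with range `Bool`: a binary tree in
which every inner node belongs to one of the players, who sends one bit depending on their own
input, and in which every leaf carries an output. -/
inductive DetProtocol (X Y : Type) : Type where
  | leaf (z : Bool) : DetProtocol X Y
  | alice (a : X → Bool) (p₀ p₁ : DetProtocol X Y) : DetProtocol X Y
  | bob (b : Y → Bool) (p₀ p₁ : DetProtocol X Y) : DetProtocol X Y

namespace DetProtocol

variable {X Y : Type}

/-- The function computed by a deterministic protocol. -/
def eval : DetProtocol X Y → X → Y → Bool
  | leaf z, _, _ => z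
  | alice a p₀ p₁, x, y => if a x then p₁.eval x y else p₀.eval x y
  | bob b p₀ p₁, x, y => if b y then p₁.eval x y else p₀.eval x y

/-- The worst-case communication cost: the height of the protocol tree. -/
def cost : DetProtocol X Y → ℕ
  | leaf _ => 0
  | alice _ p₀ p₁ => max p₀.cost p₁.cost + 1
  | bob _ p₀ p₁ => max p₀.cost p₁.cost + 1

end DetProtocol

/-! ### Guess protocols and `PP` -/

/-- A guess protocol: a finite nonempty sequence of deterministic protocols. -/
structure GuessProtocol (X Y : Type) : Type where
  guesses : ℕ
  guesses_pos : 0 < guesses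
  protocol : Fin guesses → DetProtocol X Y

namespace GuessProtocol

variable {X Y : Type}

/-- The number of accepting guesses. -/
def acc (P : GuessProtocol X Y) (x : X) (y : Y) : ℕ :=
  (Finset.univ.filter fun i => (P.protocol i).eval x y = true).card

/-- The number of rejecting guesses. -/
def rej (P : GuessProtocol X Y) (x : X) (y : Y) : ℕ :=
  (Finset.univ.filter fun i => (P.protocol i).eval x y = false).card

/-- `P` computes `f` in the `PP` acceptance mode. -/
def ComputesPP (P : GuessProtocol X Y) (f : X → Y → Prop) : Prop :=
  ∀ x y, f x y ↔ P.rej x y < P.acc x y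

/-- The worst-case cost `⌈log₂ l⌉ + max_i D(Π_i)` of a guess protocol with `l` guesses. -/
def cost (P : GuessProtocol X Y) : ℕ :=
  Nat.clog 2 P.guesses + Finset.univ.sup fun i => (P.protocol i).cost

end GuessProtocol

/-- The worst-case `PP` communication complexity of `f`: the minimum cost of a guess protocol that
computes `f` in the `PP` acceptance mode. -/
noncomputable def ppComplexity {X Y : Type} (f : X → Y → Prop) : ℕ :=
  sInf {c : ℕ | ∃ P : GuessProtocol X Y, P.ComputesPP f ∧ P.cost = c}

/-- On finite domains the minimum in `ppComplexity` is taken over a nonempty set. -/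
theorem ppComplexity_set_nonempty {X Y : Type} [Finite X] (f : X → Y → Prop) :
    {c : ℕ | ∃ P : GuessProtocol X Y, P.ComputesPP f ∧ P.cost = c}.Nonempty := by
  classical
  have key : ∀ s : Finset X, ∃ p : DetProtocol X Y,
      ∀ x ∈ s, ∀ y, p.eval x y = decide (f x y) := by
    intro s
    induction s using Finset.induction_on with
    | empty => exact ⟨.leaf false, by simp⟩
    | insert a s _ ih =>
      obtain ⟨p, hp⟩ := ih
      refine ⟨.alice (fun x => decide (x = a)) p
        (.bob (fun y => decide (f a y)) (.leaf false) (.leaf true)), ?_⟩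
      intro x hx y
      by_cases h : x = a
      · subst h
        by_cases hf : f x y <;> simp [DetProtocol.eval, hf]
      · have hx' : x ∈ s := (Finset.mem_insert.mp hx).resolve_left h
        simp [DetProtocol.eval, h, hp x hx' y]
  have := Fintype.ofFinite X
  obtain ⟨p, hp⟩ := key Finset.univ
  refine ⟨_, ⟨1, one_pos, fun _ => p⟩, ?_, rfl⟩
  intro x y
  have h := hp x (Finset.mem_univ x) y
  by_cases hf : f x y <;>
    simp [GuessProtocol.acc, GuessProtocol.rej, h, hf]

/-- The class `PP^cc`. -/
def PPcc : Set CCLanguage :=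
  {L | IsPolylog fun n => ppComplexity (L.nsection n)}

/-! ### The `BP`-operator -/

/-- The pairing `⟨x, r⟩` of binary strings: every bit of `x` is doubled, then comes the separator
`01`, then `r`. -/
def pairing (x r : List Bool) : List Bool :=
  (x.flatMap fun b => [b, b]) ++ (false :: true :: r)

theorem length_pairing (x r : List Bool) :
    (pairing x r).length = 2 * x.length + 2 + r.length := by
  induction x with
  | nil => simp [pairing]; omega
  | cons b x ih => simp only [pairing, List.flatMap_cons, List.length_append, List.length_cons,
      List.length_nil] at ih ⊢; omega

theorem pairing_injective {x x' r r' : List Bool} (h : pairing x r = pairing x' r') :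
    x = x' ∧ r = r' := by
  induction x generalizing x' with
  | nil => cases x' with
    | nil => simpa [pairing] using h
    | cons b x' => cases b <;> simp [pairing] at h
  | cons a x ih => cases x' with
    | nil => cases a <;> simp [pairing] at h
    | cons b x' =>
      simp only [pairing, List.flatMap_cons, List.cons_append, List.nil_append,
        List.cons.injEq] at h
      obtain ⟨h1, -, h2⟩ := h
      obtain ⟨h3, h4⟩ := ih h2
      exact ⟨by rw [h1, h3], h4⟩

/-- The input pair `(⟨x, r⟩, ⟨y, r⟩)`. -/
def withRandom {n m : ℕ} (x y : Word n) (r : Word m) : EqLenPair :=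
  ⟨(pairing x.toList r.toList, pairing y.toList r.toList), by simp [length_pairing]⟩

/-- The fraction of the strings `r` of `m` bits for which `(⟨x, r⟩, ⟨y, r⟩)` lies in `L'`. -/
noncomputable def acceptFraction (L' : CCLanguage) {n : ℕ} (m : ℕ) (x y : Word n) : ℝ :=
  ({r : Word m | withRandom x y r ∈ L'}.ncard : ℝ) / 2 ^ m

/-- `q` is a polynomially bounded function of a nonnegative real argument. -/
def PolyBounded (q : ℝ → ℝ) : Prop :=
  ∃ c : ℕ, ∀ t : ℝ, 0 ≤ t → 0 ≤ q t ∧ q t ≤ c * t ^ c + c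

/-- The operator `BP·C` on communication complexity classes. -/
def BP (C : Set CCLanguage) : Set CCLanguage :=
  {L | ∃ L' ∈ C, ∃ q : ℝ → ℝ, PolyBounded q ∧ ∀ (n : ℕ) (x y : Word n),
    (¬ L.nsection n x y → acceptFraction L' ⌈q (Real.logb 2 n)⌉₊ x y ≤ 1 / 3) ∧
    (L.nsection n x y → 2 / 3 ≤ acceptFraction L' ⌈q (Real.logb 2 n)⌉₊ x y)}

/-! ### The polynomial hierarchy -/

/-- `AltQuant b [l₁, …, l_k] R` says `Q₁ u₁ Q₂ u₂ … Q_k u_k, R (u₁ u₂ ⋯ u_k)`, where `u_i` ranges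
over the words of `l_i` bits and the quantifiers alternate, starting with `∃` if `b` is `true` and
with `∀` if `b` is `false`. -/
def AltQuant : Bool → List ℕ → (List Bool → Prop) → Prop
  | _, [], R => R []
  | true, l :: ls, R => ∃ u : Word l, AltQuant false ls fun v => R (u.toList ++ v)
  | false, l :: ls, R => ∀ u : Word l, AltQuant true ls fun v => R (u.toList ++ v)

/-- The class `Σ_k^cc`, for `k ≥ 1`, as defined by Babai, Frankl and Simon: `(x, y) ∈ L` iff
`∃ u₁ ∀ u₂ … Q_k u_k, φ(x, u) ◇ ψ(y, u)` with `u = u₁ ⋯ u_k` and `|u_i|` polylogarithmic in `n`, where `◇`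
is `∨` for even `k` and `∧` for odd `k`. -/
def SigmaCC (k : ℕ) : Set CCLanguage :=
  {L | ∃ l : Fin k → ℕ → ℕ, (∀ i, IsPolylog (l i)) ∧
    ∃ φ ψ : (n : ℕ) → Word n → List Bool → Bool, ∀ (n : ℕ) (x y : Word n),
      L.nsection n x y ↔ AltQuant true (List.ofFn fun i => l i n) fun u =>
        if Even k then φ n x u = true ∨ ψ n y u = true
        else φ n x u = true ∧ ψ n y u = true}

/-- The polynomial hierarchy `PH^cc`, the union of the classes `Σ_k^cc`, `k ≥ 1`. -/
def PHcc : Set CCLanguage :=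
  {L | ∃ k : ℕ, 1 ≤ k ∧ L ∈ SigmaCC k}

end CommCC

/-!
The polynomial hierarchy is evaluated by random integer-valued expressions that are sums of few
signed rectangles, and the sign of such a sum is what a `PP` protocol computes.

*Signed sums.* `HasSignedRank s g` says that `g` is a sum of `s` products `a x * b y` with factors in
`{-1, 0, 1}`. The number of terms adds under sums and multiplies under products, because a product
of rectangles is again a rectangle. If `s = 2 ^ e`, the sign of `g` has `PP` complexity at most
`e + 5` (`HasSignedRank.ppComplexity_le`).

*Random disjunctions.* For sets `S j` and `0`-`1` values `f u`, the integer
`1 - ∏ j, (1 - ∑ u ∈ S j, f u)` is `0` if all the `f u` vanish, and it is exactly `1` if some `S j`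
contains exactly one `u` with `f u = 1`. Affine hashing over a field of characteristic two provides
such isolating families from polylogarithmically many random bits, with an error probability that is
as small as a union bound over all prefixes `u₁ ⋯ u_i` requires (`exists_isolating_family`). Replacing
every quantifier by this expression, with the same random bits throughout, gives a value that with
probability `3/4` is exactly the truth value (`card_approxQuant_ne_le`), while for a fixed number of
quantifiers it remains a signed sum of `2 ^ polylog` rectangles (`HasSignedRank.approxQuant`).

*The language in `PP`.* It consists of the pairs `(⟨x, r⟩, ⟨y, r⟩)` for which the value at `x`, `y`
with random bits `r` is positive. The number of random bits is monotone in `n`, so the length of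
`⟨x, r⟩` determines `n`, and each player decodes `r` from their own input
(`ppComplexity_signLanguage_le`).
-/

namespace CommCC

open Finset

/-! ### Signed sums of rectangles -/

/-- `g` is a sum of at most `s` products `a i x * b i y` whose factors take values in
`{-1, 0, 1}`. Such a product is a difference of combinatorial rectangles, so that `s` bounds the
number of guesses needed to evaluate `g`; unlike the rank of a matrix, `s` also limits the size of
the values of `g`. -/
def HasSignedRank {X Y : Type} (s : ℕ) (g : X → Y → ℤ) : Prop :=
  ∃ (ι : Type) (_ : Fintype ι) (a : ι → X → ℤ) (b : ι → Y → ℤ),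
    Fintype.card ι ≤ s ∧ (∀ i x, |a i x| ≤ 1) ∧ (∀ i y, |b i y| ≤ 1) ∧
    ∀ x y, g x y = ∑ i, a i x * b i y

namespace HasSignedRank

variable {X Y X' Y' : Type} {s t : ℕ} {g h : X → Y → ℤ}

theorem mono (hg : HasSignedRank s g) (hst : s ≤ t) : HasSignedRank t g := by
  obtain ⟨ι, _, a, b, hc, ha, hb, hg⟩ := hg
  exact ⟨ι, _, a, b, hc.trans hst, ha, hb, hg⟩

theorem of_mul (a : X → ℤ) (b : Y → ℤ) (ha : ∀ x, |a x| ≤ 1) (hb : ∀ y, |b y| ≤ 1) :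
    HasSignedRank 1 fun x y => a x * b y :=
  ⟨Unit, inferInstance, fun _ => a, fun _ => b, by simp, fun _ => ha, fun _ => hb, by simp⟩

theorem zero : HasSignedRank 0 fun (_ : X) (_ : Y) => (0 : ℤ) :=
  ⟨Empty, inferInstance, fun _ _ => 0, fun _ _ => 0, by simp, by simp, by simp, by simp⟩

theorem one : HasSignedRank 1 fun (_ : X) (_ : Y) => (1 : ℤ) := by
  simpa using of_mul (fun _ : X => 1) (fun _ : Y => 1) (by simp) (by simp)

theorem neg (hg : HasSignedRank s g) : HasSignedRank s fun x y => -g x y := by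
  obtain ⟨ι, _, a, b, hc, ha, hb, hg⟩ := hg
  refine ⟨ι, _, fun i x => -a i x, b, hc, by simpa using ha, hb, fun x y => ?_⟩
  simp [hg]

theorem add (hg : HasSignedRank s g) (hh : HasSignedRank t h) :
    HasSignedRank (s + t) fun x y => g x y + h x y := by
  obtain ⟨ι, _, a, b, hc, ha, hb, hg⟩ := hg
  obtain ⟨κ, _, a', b', hc', ha', hb', hh⟩ := hh
  refine ⟨ι ⊕ κ, inferInstance, Sum.elim a a', Sum.elim b b', ?_, ?_, ?_, fun x y => ?_⟩
  · simpa using add_le_add hc hc'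
  · rintro (i | i) x <;> simp [ha, ha']
  · rintro (i | i) y <;> simp [hb, hb']
  · simp [hg, hh]

theorem sub (hg : HasSignedRank s g) (hh : HasSignedRank t h) :
    HasSignedRank (s + t) fun x y => g x y - h x y := by
  simpa [sub_eq_add_neg] using hg.add hh.neg

theorem mul (hg : HasSignedRank s g) (hh : HasSignedRank t h) :
    HasSignedRank (s * t) fun x y => g x y * h x y := by
  obtain ⟨ι, _, a, b, hc, ha, hb, hg⟩ := hg
  obtain ⟨κ, _, a', b', hc', ha', hb', hh⟩ := hh
  refine ⟨ι × κ, inferInstance, fun i x => a i.1 x * a' i.2 x, fun i y => b i.1 y * b' i.2 y,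
    ?_, ?_, ?_, fun x y => ?_⟩
  · simpa using Nat.mul_le_mul hc hc'
  · intro i x
    rw [abs_mul]
    exact mul_le_one₀ (ha _ _) (abs_nonneg _) (ha' _ _)
  · intro i y
    rw [abs_mul]
    exact mul_le_one₀ (hb _ _) (abs_nonneg _) (hb' _ _)
  · simp only [hg, hh]
    rw [Fintype.sum_mul_sum, Fintype.sum_prod_type]
    exact sum_congr rfl fun i _ => sum_congr rfl fun j _ => by ring

theorem sum {U : Type} (I : Finset U) {f : U → X → Y → ℤ} (hf : ∀ u, HasSignedRank s (f u)) :
    HasSignedRank (#I * s) fun x y => ∑ u ∈ I, f u x y := by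
  classical
  induction I using Finset.induction_on with
  | empty => simpa using zero
  | insert u I hu ih =>
    simp only [sum_insert hu, card_insert_of_notMem hu]
    exact ((hf u).add ih).mono (by rw [add_mul, one_mul, add_comm])

theorem prod {U : Type} (I : Finset U) {f : U → X → Y → ℤ} (hf : ∀ u, HasSignedRank s (f u)) :
    HasSignedRank (s ^ #I) fun x y => ∏ u ∈ I, f u x y := by
  classical
  induction I using Finset.induction_on with
  | empty => simpa using one
  | insert u I hu ih =>
    simp only [prod_insert hu, card_insert_of_notMem hu]
    exact ((hf u).mul ih).mono (by rw [pow_succ'])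

theorem comp (hg : HasSignedRank s g) (p : X' → X) (q : Y' → Y) :
    HasSignedRank s fun x y => g (p x) (q y) := by
  obtain ⟨ι, _, a, b, hc, ha, hb, hg⟩ := hg
  exact ⟨ι, _, fun i x => a i (p x), fun i y => b i (q y), hc, fun i x => ha i _,
    fun i y => hb i _, fun x y => hg _ _⟩

end HasSignedRank

/-! ### Guess protocols from signed sums -/

/-- The protocol that outputs `z` if `0 < a x * b y`, and the other bit otherwise. -/
def posProtocol {X Y : Type} (a : X → ℤ) (b : Y → ℤ) (z : Bool) : DetProtocol X Y :=
  .alice (fun x => decide (0 < a x))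
    (.alice (fun x => decide (a x < 0)) (.leaf !z)
      (.bob (fun y => decide (b y < 0)) (.leaf !z) (.leaf z)))
    (.bob (fun y => decide (0 < b y)) (.leaf !z) (.leaf z))

theorem posProtocol_eval {X Y : Type} (a : X → ℤ) (b : Y → ℤ) (z : Bool) (x : X) (y : Y) :
    (posProtocol a b z).eval x y = if 0 < a x * b y then z else !z := by
  simp only [posProtocol, DetProtocol.eval, mul_pos_iff, decide_eq_true_eq]
  split_ifs <;> first | rfl | (exfalso; omega)

theorem posProtocol_cost {X Y : Type} (a : X → ℤ) (b : Y → ℤ) (z : Bool) :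
    (posProtocol a b z).cost = 3 := rfl

/-- A guess protocol given by protocols indexed by a finite type, with its gap between accepting and
rejecting guesses written as a signed sum. -/
theorem exists_guessProtocol {X Y κ : Type} [Fintype κ] [Nonempty κ] (P : κ → DetProtocol X Y)
    {c : ℕ} (hP : ∀ i, (P i).cost ≤ c) :
    ∃ Q : GuessProtocol X Y, Q.cost ≤ Nat.clog 2 (Fintype.card κ) + c ∧
      ∀ x y, (Q.acc x y : ℤ) - Q.rej x y = ∑ i, if (P i).eval x y then 1 else -1 := by
  refine ⟨⟨Fintype.card κ, Fintype.card_pos, fun i => P ((Fintype.equivFin κ).symm i)⟩, ?_, ?_⟩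
  · exact Nat.add_le_add_left (Finset.sup_le fun i _ => hP _) _
  · intro x y
    rw [← Equiv.sum_comp (Fintype.equivFin κ).symm]
    simp only [GuessProtocol.acc, GuessProtocol.rej, card_filter, Nat.cast_sum,
      ← sum_sub_distrib]
    refine sum_congr rfl fun i _ => ?_
    cases (P ((Fintype.equivFin κ).symm i)).eval x y <;> simp

theorem ppComplexity_le {X Y : Type} {f : X → Y → Prop} {P : GuessProtocol X Y}
    (hP : P.ComputesPP f) : ppComplexity f ≤ P.cost :=
  Nat.sInf_le ⟨P, hP, rfl⟩

/-- The sign of a signed sum of `2 ^ e` rectangles is computed in the `PP` mode with about `e` bits: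
each term contributes twice its value to the gap, and one more rejecting guess breaks ties. -/
theorem HasSignedRank.ppComplexity_le {X Y : Type} {e : ℕ} {g : X → Y → ℤ}
    (hg : HasSignedRank (2 ^ e) g) {f : X → Y → Prop} (hf : ∀ x y, f x y ↔ 0 < g x y) :
    ppComplexity f ≤ e + 5 := by
  obtain ⟨ι, _, a, b, hc, ha, hb, hg⟩ := hg
  obtain ⟨Q, hQc, hQ⟩ := exists_guessProtocol (c := 3)
    (fun i : Option (ι ⊕ ι) => i.elim (.leaf false) <| Sum.elim
      (fun i => posProtocol (a i) (b i) true) (fun i => posProtocol (fun x => -a i x) (b i) false))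
    (by rintro (_ | i | i) <;> simp [posProtocol_cost, DetProtocol.cost])
  have hcost : Q.cost ≤ e + 5 := by
    have h : Nat.clog 2 (Fintype.card (Option (ι ⊕ ι))) ≤ e + 2 := by
      refine Nat.clog_le_of_le_pow ?_
      have := Nat.one_le_two_pow (n := e)
      simp only [Fintype.card_option, Fintype.card_sum, pow_succ]
      omega
    omega
  refine (CommCC.ppComplexity_le fun x y => ?_).trans hcost
  have key : (Q.acc x y : ℤ) - Q.rej x y = 2 * g x y - 1 := by
    rw [hQ, Fintype.sum_option, Fintype.sum_sum_type, hg, ← sum_add_distrib, mul_sum,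
      sub_eq_neg_add]
    congr 1
    refine sum_congr rfl fun i _ => ?_
    have h1 : |a i x * b i y| ≤ 1 := by
      rw [abs_mul]
      exact mul_le_one₀ (ha _ _) (abs_nonneg _) (hb _ _)
    rw [abs_le] at h1
    simp only [Option.elim, Sum.elim_inl, Sum.elim_inr, posProtocol_eval, neg_mul]
    generalize a i x * b i y = v at h1
    split_ifs <;> simp_all <;> omega
  rw [hf]
  omega

/-! ### Polylogarithmic bounds -/

theorem logb_two_natCast_nonneg (n : ℕ) : 0 ≤ Real.logb 2 n := by
  rcases n.eq_zero_or_pos with rfl | h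
  · simp
  · exact Real.logb_nonneg (by norm_num) (by exact_mod_cast h)

theorem logb_two_natCast_mono {m n : ℕ} (h : m ≤ n) : Real.logb 2 m ≤ Real.logb 2 n := by
  rcases m.eq_zero_or_pos with rfl | hm
  · simpa using logb_two_natCast_nonneg n
  · exact Real.logb_le_logb_of_le (by norm_num) (by exact_mod_cast hm) (by exact_mod_cast h)

/-- A form of the polylogarithmic bound that is monotone in the constant. -/
theorem isPolylog_iff {f : ℕ → ℕ} :
    IsPolylog f ↔ ∃ c : ℕ, ∀ n : ℕ, (f n : ℝ) ≤ c * (1 + Real.logb 2 n) ^ c := by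
  have h0 := logb_two_natCast_nonneg
  constructor
  · rintro ⟨c, hc⟩
    refine ⟨2 * c, fun n => (hc n).trans ?_⟩
    have h1 : Real.logb 2 n ^ c ≤ (1 + Real.logb 2 n) ^ (2 * c) :=
      (pow_le_pow_left₀ (h0 n) (by linarith) c).trans
        (pow_le_pow_right₀ (by linarith [h0 n]) (by omega))
    have h2 : 1 ≤ (1 + Real.logb 2 n) ^ (2 * c) := one_le_pow₀ (by linarith [h0 n])
    push_cast
    nlinarith [(Nat.cast_nonneg c : (0 : ℝ) ≤ c)]
  · rintro ⟨c, hc⟩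
    refine ⟨c * 2 ^ c, fun n => (hc n).trans ?_⟩
    have hc0 : (0 : ℝ) ≤ c := Nat.cast_nonneg c
    have ht := h0 n
    generalize Real.logb 2 n = t at ht
    push_cast
    rcases le_total t 1 with h | h
    · have h1 : (1 + t) ^ c ≤ 2 ^ c := pow_le_pow_left₀ (by linarith) (by linarith) c
      have h2 : 0 ≤ (c * 2 ^ c : ℝ) * t ^ (c * 2 ^ c) := by positivity
      nlinarith [mul_le_mul_of_nonneg_left h1 hc0]
    · have h1 : (1 + t) ^ c ≤ 2 ^ c * t ^ (c * 2 ^ c) := by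
        calc (1 + t) ^ c ≤ (2 * t) ^ c := pow_le_pow_left₀ (by linarith) (by linarith) c
          _ = 2 ^ c * t ^ c := mul_pow ..
          _ ≤ _ := by
            gcongr
            exact Nat.le_mul_of_pos_right _ (by positivity)
      have h2 : 0 ≤ (c * 2 ^ c : ℝ) := by positivity
      nlinarith [mul_le_mul_of_nonneg_left h1 hc0]

namespace IsPolylog

variable {f g : ℕ → ℕ}

theorem const (k : ℕ) : IsPolylog fun _ => k :=
  isPolylog_iff.2 ⟨k, fun n => le_mul_of_one_le_right (Nat.cast_nonneg k)
    (one_le_pow₀ (by linarith [logb_two_natCast_nonneg n]))⟩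

theorem mono (hg : IsPolylog g) (h : ∀ n, f n ≤ g n) : IsPolylog f := by
  obtain ⟨c, hc⟩ := hg
  exact ⟨c, fun n => (Nat.cast_le.2 (h n)).trans (hc n)⟩

theorem add (hf : IsPolylog f) (hg : IsPolylog g) : IsPolylog fun n => f n + g n := by
  obtain ⟨c, hc⟩ := isPolylog_iff.1 hf
  obtain ⟨d, hd⟩ := isPolylog_iff.1 hg
  refine isPolylog_iff.2 ⟨c + d, fun n => ?_⟩
  have ht : 1 ≤ 1 + Real.logb 2 n := by linarith [logb_two_natCast_nonneg n]
  push_cast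
  rw [add_mul]
  refine add_le_add ((hc n).trans ?_) ((hd n).trans ?_) <;> gcongr <;> first | exact ht | omega

theorem mul (hf : IsPolylog f) (hg : IsPolylog g) : IsPolylog fun n => f n * g n := by
  obtain ⟨c, hc⟩ := isPolylog_iff.1 hf
  obtain ⟨d, hd⟩ := isPolylog_iff.1 hg
  refine isPolylog_iff.2 ⟨c * d + c + d, fun n => ?_⟩
  have ht : 1 ≤ 1 + Real.logb 2 n := by linarith [logb_two_natCast_nonneg n]
  push_cast
  calc (f n * g n : ℝ) ≤ (c * (1 + Real.logb 2 n) ^ c) * (d * (1 + Real.logb 2 n) ^ d) :=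
        mul_le_mul (hc n) (hd n) (Nat.cast_nonneg _) (by positivity)
    _ = (c * d) * (1 + Real.logb 2 n) ^ (c + d) := by ring
    _ ≤ (c * d + c + d) * (1 + Real.logb 2 n) ^ (c * d + c + d) := by
        have h1 : (0 : ℝ) ≤ c := Nat.cast_nonneg c
        have h2 : (0 : ℝ) ≤ d := Nat.cast_nonneg d
        exact mul_le_mul (by linarith) (pow_le_pow_right₀ ht (by omega)) (by positivity)
          (by positivity)

theorem sum {ι : Type} (s : Finset ι) {f : ι → ℕ → ℕ} (hf : ∀ i, IsPolylog (f i)) :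
    IsPolylog fun n => ∑ i ∈ s, f i n := by
  classical
  induction s using Finset.induction_on with
  | empty => simpa using const 0
  | insert i s hi ih => simpa [sum_insert hi] using (hf i).add ih

end IsPolylog

theorem IsPolylog.of_le_comp {f g : ℕ → ℕ} (hg : IsPolylog g)
    (h : ∀ n, ∃ k ≤ n, f n ≤ g k) : IsPolylog f := by
  obtain ⟨c, hc⟩ := isPolylog_iff.1 hg
  refine isPolylog_iff.2 ⟨c, fun n => ?_⟩
  obtain ⟨k, hk, hf⟩ := h n
  have h1 := logb_two_natCast_mono hk
  have h2 := logb_two_natCast_nonneg k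
  calc (f n : ℝ) ≤ g k := by exact_mod_cast hf
    _ ≤ c * (1 + Real.logb 2 k) ^ c := hc k
    _ ≤ _ := by gcongr

/-! ### Isolation by affine hashing -/

section Isolation

variable {K : Type} [Field K] [Fintype K] [DecidableEq K]

theorem card_affine_mem (A : Finset K) (w : K) :
    #{c : K × K | c.1 * w + c.2 ∈ A} = Fintype.card K * #A := by
  rw [← card_univ (α := K), ← card_product]
  refine card_nbij' (fun c => (c.1, c.1 * w + c.2)) (fun d => (d.1, d.2 - d.1 * w)) ?_ ?_ ?_ ?_
  · intro c; simp
  · intro c; simp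
  · intro c; simp
  · intro c; simp

theorem card_affine_mem_and_mem (A : Finset K) {w v : K} (h : w ≠ v) :
    #{c : K × K | c.1 * w + c.2 ∈ A ∧ c.1 * v + c.2 ∈ A} = #A * #A := by
  have h' : w - v ≠ 0 := sub_ne_zero.2 h
  have key (a b : K) : (a - b) / (w - v) * v + (a - (a - b) / (w - v) * w) = b := by
    field_simp
    ring
  rw [← card_product]
  refine card_nbij' (fun c => (c.1 * w + c.2, c.1 * v + c.2))
    (fun d => ((d.1 - d.2) / (w - v), d.1 - (d.1 - d.2) / (w - v) * w)) ?_ ?_ ?_ ?_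
  · intro c; simp
  · rintro ⟨a, b⟩
    simp [key]
  · rintro ⟨a, b⟩ -
    have : (a * w + b - (a * v + b)) / (w - v) = a := by
      field_simp
      ring
    simp only [this, Prod.mk.injEq, true_and]
    ring
  · rintro ⟨a, b⟩ -
    simp [key]

/-- A second moment bound: for pairwise independent hashing, if the expected number of `w ∈ T` whose
hash lies in `A` is between `1/4` and `1/2`, then with probability at least `3/16` there is exactly
one such `w`. -/
theorem card_not_isolating_le (A T : Finset K) (h1 : Fintype.card K ≤ 4 * (#T * #A))
    (h2 : 2 * (#T * #A) ≤ Fintype.card K) :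
    16 * #{c : K × K | #{w ∈ T | c.1 * w + c.2 ∈ A} ≠ 1} ≤ 13 * Fintype.card K ^ 2 := by
  set Z : K × K → ℤ := fun c => ∑ w ∈ T, if c.1 * w + c.2 ∈ A then 1 else 0 with hZ
  have hZc (c : K × K) : Z c = #{w ∈ T | c.1 * w + c.2 ∈ A} := by simp [hZ]
  have hsum : ∑ c, Z c = #T * (Fintype.card K * #A) := by
    rw [hZ, sum_comm]
    simp only [sum_boole, card_affine_mem, sum_const, nsmul_eq_mul, Nat.cast_mul]
  have hsq : ∑ c, Z c ^ 2 ≤ #T * (Fintype.card K * #A) + #T * (#T * (#A * #A)) := by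
    have (c : K × K) : Z c ^ 2 =
        ∑ w ∈ T, ∑ v ∈ T, if c.1 * w + c.2 ∈ A ∧ c.1 * v + c.2 ∈ A then 1 else 0 := by
      rw [sq, hZ, sum_mul_sum]
      refine sum_congr rfl fun w _ => sum_congr rfl fun v _ => ?_
      split_ifs <;> simp_all
    simp only [this]
    rw [sum_comm]
    calc _ ≤ ∑ w ∈ T, ((Fintype.card K * #A : ℤ) + #T * (#A * #A)) := by
          refine sum_le_sum fun w hw => ?_
          rw [sum_comm]
          calc _ ≤ ∑ v ∈ T, ((if w = v then (Fintype.card K * #A : ℤ) else 0) + #A * #A) := by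
                refine sum_le_sum fun v _ => ?_
                rw [sum_boole]
                split_ifs with h
                · subst h
                  simp only [and_self, card_affine_mem]
                  push_cast
                  linarith [mul_nonneg (Nat.cast_nonneg (α := ℤ) #A) (Nat.cast_nonneg #A)]
                · rw [card_affine_mem_and_mem A h]
                  simp
            _ = _ := by simp [sum_add_distrib, hw]
      _ = _ := by simp [mul_add]
  -- The integer inequality `2 * Z - Z ^ 2 ≤ 0` holds unless `Z = 1`.
  have hone : ∑ c, (2 * Z c - Z c ^ 2) ≤
      (#{c : K × K | #{w ∈ T | c.1 * w + c.2 ∈ A} = 1} : ℤ) := by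
    rw [← sum_boole]
    refine sum_le_sum fun c _ => ?_
    have := hZc c
    split_ifs with h
    · rw [this, h]; norm_num
    · rcases Nat.lt_or_gt_of_ne h with h | h
      · rw [this, Nat.lt_one_iff.1 h]; norm_num
      · have : 2 ≤ Z c := by rw [this]; exact_mod_cast h
        nlinarith
  rw [sum_sub_distrib, ← mul_sum, hsum] at hone
  have hcard := card_filter_add_card_filter_not (s := (univ : Finset (K × K)))
    (fun c => #{w ∈ T | c.1 * w + c.2 ∈ A} = 1)
  rw [card_univ, Fintype.card_prod] at hcard
  simp only [ne_eq]
  generalize #{c : K × K | #{w ∈ T | c.1 * w + c.2 ∈ A} = 1} = G at hone hcard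
  generalize #{c : K × K | ¬ #{w ∈ T | c.1 * w + c.2 ∈ A} = 1} = B at hcard ⊢
  zify at hcard h1 h2 ⊢
  generalize (Fintype.card K : ℤ) = q at *
  have h3 : (0 : ℤ) ≤ (4 * (#T * #A) - q) * (3 * q - 4 * (#T * #A)) :=
    mul_nonneg (by linarith)
      (by linarith [mul_nonneg (Nat.cast_nonneg (α := ℤ) #T) (Nat.cast_nonneg #A)])
  linarith

end Isolation

/-- Every nonempty subset of a set with `2 ^ N` elements is cut down to one element by some member
of a random family of `4 * p * (N + 1)` sets, except with probability `2 ^ (-p)`. The families are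
indexed by `8 * p * (N + 1)` random bits. -/
theorem exists_isolating_family (N p : ℕ) :
    ∃ S : Fin (2 ^ (8 * p * (N + 1))) → Fin (4 * p * (N + 1)) → Finset (Fin (2 ^ N)),
      ∀ T : Finset (Fin (2 ^ N)), T.Nonempty →
        2 ^ p * #{ω | ∀ j, #(S ω j ∩ T) ≠ 1} ≤ 2 ^ (8 * p * (N + 1)) := by
  classical
  let K := GaloisField 2 (N + 1)
  have : Fintype K := Fintype.ofFinite K
  have hK : Fintype.card K = 2 ^ (N + 1) := by
    rw [← Nat.card_eq_fintype_card]
    exact GaloisField.card 2 (N + 1) (by omega)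
  obtain ⟨e⟩ : Nonempty (Fin (2 ^ N) ↪ K) := by
    refine Function.Embedding.nonempty_of_card_le ?_
    rw [hK, Fintype.card_fin]
    exact Nat.pow_le_pow_right (by norm_num) (by omega)
  -- Hash values are compared with a set of each size `2 ^ i`, as the size of `T` is not known.
  have hA (i : Fin (N + 1)) : ∃ A : Finset K, #A = 2 ^ (i : ℕ) := by
    obtain ⟨A, -, hA⟩ := exists_subset_card_eq (s := (univ : Finset K)) (n := 2 ^ (i : ℕ))
      (by rw [card_univ, hK]; exact Nat.pow_le_pow_right (by norm_num) (by omega))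
    exact ⟨A, hA⟩
  choose A hA using hA
  have eΩ : Fin (2 ^ (8 * p * (N + 1))) ≃ (Fin (4 * p) → K × K) := by
    refine Fintype.equivOfCardEq ?_
    rw [Fintype.card_fin, Fintype.card_fun, Fintype.card_prod, hK, Fintype.card_fin, ← pow_add,
      ← pow_mul]
    congr 1
    ring
  have eJ : Fin (4 * p * (N + 1)) ≃ Fin (4 * p) × Fin (N + 1) := finProdFinEquiv.symm
  let S (c : K × K) (i : Fin (N + 1)) : Finset (Fin (2 ^ N)) := {u | c.1 * e u + c.2 ∈ A i}
  refine ⟨fun ω j => S (eΩ ω (eJ j).1) (eJ j).2, fun T hT => ?_⟩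
  have hone : 16 * #{c | ∀ i, #(S c i ∩ T) ≠ 1} ≤ 13 * Fintype.card K ^ 2 := by
    have hT0 : 0 < #T := hT.card_pos
    have hTN : #T ≤ 2 ^ N := by simpa using card_le_univ T
    have hd : 2 ^ N / #T ≠ 0 := (Nat.div_pos hTN hT0).ne'
    -- This choice gives `2 ^ N < 2 * (#T * 2 ^ i) ≤ 2 * 2 ^ N`, an expected count in `(1/4, 1/2]`.
    set i := Nat.log 2 (2 ^ N / #T)
    have h1 : 2 ^ i ≤ 2 ^ N / #T := Nat.pow_log_le_self 2 hd
    have h2 : 2 ^ N / #T < 2 ^ (i + 1) := Nat.lt_pow_succ_log_self (by norm_num) _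
    have hiN : i < N + 1 := by
      have : 2 ^ i ≤ 2 ^ N := h1.trans (Nat.div_le_self _ _)
      exact Nat.lt_succ_of_le ((Nat.pow_le_pow_iff_right (by norm_num)).1 this)
    rw [Nat.le_div_iff_mul_le hT0] at h1
    rw [Nat.div_lt_iff_lt_mul hT0] at h2
    have key := card_not_isolating_le (A ⟨i, hiN⟩) (T.map e)
      (by rw [card_map, hA, hK]; simp only [pow_succ] at *; nlinarith)
      (by rw [card_map, hA, hK]; simp only [pow_succ] at *; nlinarith)
    refine le_trans (Nat.mul_le_mul_left _ (card_le_card fun c => ?_)) key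
    simp only [mem_filter, mem_univ, true_and]
    intro h
    convert h ⟨i, hiN⟩ using 2
    rw [filter_map, card_map]
    congr 1
    ext u
    simp [S, and_comm]
  have hpow : #{ω | ∀ j, #(S (eΩ ω (eJ j).1) (eJ j).2 ∩ T) ≠ 1} =
      #{c | ∀ i, #(S c i ∩ T) ≠ 1} ^ (4 * p) := by
    rw [← Fintype.card_piFinset_const]
    refine card_equiv eΩ fun ω => ?_
    simp only [mem_filter, mem_univ, true_and, Fintype.mem_piFinset]
    rw [eJ.forall_congr_left]
    simp [Prod.forall]
  rw [hpow]
  -- Four independent trials halve the error probability, as `2 * 13 ^ 4 ≤ 16 ^ 4`.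
  have h16 : 16 ^ (4 * p) * (2 ^ p * #{c | ∀ i, #(S c i ∩ T) ≠ 1} ^ (4 * p)) ≤
      16 ^ (4 * p) * 2 ^ (8 * p * (N + 1)) := by
    calc _ = 2 ^ p * (16 * #{c | ∀ i, #(S c i ∩ T) ≠ 1}) ^ (4 * p) := by rw [mul_pow]; ring
      _ ≤ 2 ^ p * (13 * Fintype.card K ^ 2) ^ (4 * p) := by gcongr
      _ = (2 * 13 ^ 4) ^ p * (Fintype.card K ^ 2) ^ (4 * p) := by
        rw [mul_pow, mul_pow, ← pow_mul 13, ← mul_assoc]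
      _ ≤ (16 ^ 4) ^ p * (Fintype.card K ^ 2) ^ (4 * p) := by gcongr; norm_num
      _ = _ := by
        rw [hK, ← pow_mul, ← pow_mul, ← pow_mul]
        congr 2
        ring
  exact Nat.le_of_mul_le_mul_left h16 (by positivity)

/-! ### Integer-valued approximation of alternating quantifiers -/

open Classical in
/-- The `0`-`1` value of a proposition. -/
noncomputable def ind (P : Prop) : ℤ := if P then 1 else 0

theorem ind_of {P : Prop} (h : P) : ind P = 1 := if_pos h

theorem ind_of_not {P : Prop} (h : ¬ P) : ind P = 0 := if_neg h

theorem one_sub_ind (P : Prop) : 1 - ind P = ind (¬ P) := by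
  by_cases h : P <;> simp [ind, h]

section Approx

variable {J V : Type} [Fintype J] [DecidableEq V]

/-- An integer-valued substitute for the disjunction of the `0`-`1` values `f u`, with respect to a
family of subsets of a set into which the index set is mapped. -/
def isoOr {U : Type} [Fintype U] (S : J → Finset V) (e : U → V) (f : U → ℤ) : ℤ :=
  1 - ∏ j, (1 - ∑ u, (if e u ∈ S j then 1 else 0) * f u)

theorem isoOr_eq {U : Type} [Fintype U] (S : J → Finset V) {e : U → V}
    (he : Function.Injective e) (Q : U → Prop) [DecidablePred Q]
    (h : (∃ u, Q u) → ∃ j, #(S j ∩ ({u | Q u} : Finset U).image e) = 1) :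
    isoOr S e (fun u => ind (Q u)) = ind (∃ u, Q u) := by
  by_cases hQ : ∃ u, Q u
  · obtain ⟨j, hj⟩ := h hQ
    have : ∑ u, (if e u ∈ S j then (1 : ℤ) else 0) * ind (Q u) = 1 := by
      have hcard : #{u | e u ∈ S j ∧ Q u} = 1 := by
        rw [← hj, ← card_image_of_injective _ he]
        congr 1
        ext v
        simp only [mem_image, mem_filter, mem_univ, true_and, mem_inter]
        constructor
        · rintro ⟨u, ⟨h1, h2⟩, rfl⟩
          exact ⟨h1, u, h2, rfl⟩
        · rintro ⟨h1, u, h2, rfl⟩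
          exact ⟨u, ⟨h1, h2⟩, rfl⟩
      have hmul (u : U) : (if e u ∈ S j then (1 : ℤ) else 0) * ind (Q u) =
          if e u ∈ S j ∧ Q u then 1 else 0 := by
        by_cases hu : Q u <;> simp [ind, hu]
      simp only [hmul, sum_boole, hcard, Nat.cast_one]
    rw [isoOr, prod_eq_zero (mem_univ j) (by rw [this, sub_self]), sub_zero, ind_of hQ]
  · rw [ind_of_not hQ]
    simp only [not_exists] at hQ
    simp [isoOr, ind, hQ]

/-- The value of an alternating quantifier prefix over integer-valued matrices, with every
quantifier replaced by `isoOr` and its dual. The same family of sets serves at all quantifiers. -/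
def approxQuant (S : J → Finset V) (e : (l : ℕ) → Word l → V) :
    Bool → List ℕ → (List Bool → ℤ) → ℤ
  | _, [], F => F []
  | true, l :: ls, F => isoOr S (e l) fun u => approxQuant S e false ls fun v => F (u.toList ++ v)
  | false, l :: ls, F =>
    1 - isoOr S (e l) fun u => 1 - approxQuant S e true ls fun v => F (u.toList ++ v)

open Classical in
/-- A union bound over all prefixes of the quantified string: outside a small set of seeds, the
isolating family isolates at every quantifier, and then the approximation is exact. -/
theorem card_approxQuant_ne_le {Ω : Type} [Fintype Ω] {p : ℕ} {S : Ω → J → Finset V}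
    (hS : ∀ T : Finset V, T.Nonempty →
      2 ^ p * #{ω | ∀ j, #(S ω j ∩ T) ≠ 1} ≤ Fintype.card Ω)
    {e : (l : ℕ) → Word l → V} (b : Bool) (ls : List ℕ)
    (he : ∀ l ∈ ls, Function.Injective (e l)) (R : List Bool → Prop) :
    2 ^ p * #{ω | approxQuant (S ω) e b ls (fun u => ind (R u)) ≠
      ind (AltQuant b ls R)} ≤ ls.length * 2 ^ ls.sum * Fintype.card Ω := by
  induction ls generalizing b R with
  | nil => simp [approxQuant, AltQuant]
  | cons l ls ih =>
    -- It is enough to find the set of indices to be isolated at the outermost quantifier.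
    have key (T : Finset V) (b' : Bool)
        (hT : ∀ ω, (T.Nonempty → ∃ j, #(S ω j ∩ T) = 1) →
          (∀ u : Word l, approxQuant (S ω) e b' ls
            (fun v => ind (R (u.toList ++ v))) =
              ind (AltQuant b' ls fun v => R (u.toList ++ v))) →
          approxQuant (S ω) e b (l :: ls) (fun u => ind (R u)) =
            ind (AltQuant b (l :: ls) R)) :
        2 ^ p * #{ω | approxQuant (S ω) e b (l :: ls) (fun u => ind (R u)) ≠
          ind (AltQuant b (l :: ls) R)} ≤
            (l :: ls).length * 2 ^ (l :: ls).sum * Fintype.card Ω := by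
      set B : Word l → Finset Ω := fun u => {ω | approxQuant (S ω) e b' ls
        (fun v => ind (R (u.toList ++ v))) ≠
          ind (AltQuant b' ls fun v => R (u.toList ++ v))} with hB
      set B₀ : Finset Ω := {ω | T.Nonempty ∧ ∀ j, #(S ω j ∩ T) ≠ 1} with hB₀
      have hsub : ({ω | approxQuant (S ω) e b (l :: ls) (fun u => ind (R u)) ≠
          ind (AltQuant b (l :: ls) R)} : Finset Ω) ⊆ B₀ ∪ univ.biUnion B := by
        intro ω hω
        by_contra hn
        simp only [hB, hB₀, mem_union, mem_filter, mem_univ, true_and, mem_biUnion, not_or,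
          not_exists, not_and, not_forall, not_not] at hn hω
        exact hω (hT ω hn.1 hn.2)
      have h0 : 2 ^ p * #B₀ ≤ Fintype.card Ω := by
        by_cases h : T.Nonempty
        · simpa [hB₀, h] using hS T h
        · simp [hB₀, h]
      have h1 : 2 ^ p * #(univ.biUnion B) ≤
          2 ^ l * (ls.length * 2 ^ ls.sum * Fintype.card Ω) := by
        calc _ ≤ 2 ^ p * ∑ u, #(B u) := Nat.mul_le_mul_left _ card_biUnion_le
          _ = ∑ u, 2 ^ p * #(B u) := mul_sum ..
          _ ≤ ∑ _u : Word l, ls.length * 2 ^ ls.sum * Fintype.card Ω :=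
            sum_le_sum fun u _ => ih b' (fun l' h => he l' (List.mem_cons_of_mem _ h)) _
          _ = _ := by simp [card_vector]
      calc _ ≤ 2 ^ p * (#B₀ + #(univ.biUnion B)) :=
            Nat.mul_le_mul_left _ ((card_le_card hsub).trans (card_union_le _ _))
        _ ≤ 1 * Fintype.card Ω + 2 ^ l * (ls.length * 2 ^ ls.sum * Fintype.card Ω) := by
          rw [mul_add, one_mul]
          exact add_le_add h0 h1
        _ ≤ 2 ^ (l + ls.sum) * Fintype.card Ω +
            2 ^ l * (ls.length * 2 ^ ls.sum * Fintype.card Ω) := by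
          gcongr
          exact Nat.one_le_two_pow
        _ = _ := by
          simp only [List.length_cons, List.sum_cons, pow_add]
          ring
    have hel : Function.Injective (e l) := he l List.mem_cons_self
    cases b with
    | true =>
      refine key (({u | AltQuant false ls fun v => R (u.toList ++ v)} : Finset (Word l)).image
        (e l)) false fun ω h1 h2 => ?_
      simp only [approxQuant, AltQuant, h2]
      exact isoOr_eq _ hel _ fun ⟨u, hu⟩ => h1 (.image ⟨u, mem_filter.2 ⟨mem_univ u, hu⟩⟩ _)
    | false =>
      refine key (({u | ¬ AltQuant true ls fun v => R (u.toList ++ v)} : Finset (Word l)).image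
        (e l)) true fun ω h1 h2 => ?_
      simp only [approxQuant, AltQuant, h2, one_sub_ind]
      have h3 := isoOr_eq (S ω) hel (fun u => ¬ AltQuant true ls fun v => R (u.toList ++ v))
        fun ⟨u, hu⟩ => h1 (.image ⟨u, mem_filter.2 ⟨mem_univ u, hu⟩⟩ _)
      rw [h3, one_sub_ind]
      simp only [not_exists, not_not]

theorem HasSignedRank.isoOr {X Y U : Type} [Fintype U] {s : ℕ} {f : U → X → Y → ℤ}
    (hf : ∀ u, HasSignedRank s (f u)) (S : J → Finset V) (e : U → V) :
    HasSignedRank (1 + (1 + Fintype.card U * s) ^ Fintype.card J)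
      fun x y => isoOr S e fun u => f u x y := by
  refine one.sub (prod univ fun j => one.sub (sum univ fun u => ?_))
  split_ifs
  · simpa using hf u
  · simpa using zero.mono (Nat.zero_le s)

/-- The logarithm of the number of terms in the approximation of `k` alternating quantifiers that
each range over at most `N` bits, when the family used for approximation has `D` members. -/
def rankExponent (D N : ℕ) : ℕ → ℕ
  | 0 => 2
  | k + 1 => D * (N + rankExponent D N k + 2) + 2

theorem HasSignedRank.approxQuant {X Y : Type} {N : ℕ} (S : J → Finset V)
    (e : (l : ℕ) → Word l → V) (b : Bool) (ls : List ℕ) (hls : ∀ l ∈ ls, l ≤ N)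
    {F : List Bool → X → Y → ℤ} (hF : ∀ u, HasSignedRank (2 ^ 2) (F u)) :
    HasSignedRank (2 ^ rankExponent (Fintype.card J) N ls.length)
      fun x y => approxQuant S e b ls fun u => F u x y := by
  induction ls generalizing b F with
  | nil => exact hF []
  | cons l ls ih =>
    set r := rankExponent (Fintype.card J) N ls.length with hr
    have hl : l ≤ N := hls l List.mem_cons_self
    have ih' (b' : Bool) (u : Word l) := ih b' (fun l' h => hls l' (List.mem_cons_of_mem _ h))
      (F := fun v => F (u.toList ++ v)) fun v => hF _
    have hbound : 2 + (1 + Fintype.card (Word l) * (1 + 2 ^ r)) ^ Fintype.card J ≤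
        2 ^ rankExponent (Fintype.card J) N (l :: ls).length := by
      have h1 : 1 + Fintype.card (Word l) * (1 + 2 ^ r) ≤ 2 ^ (N + r + 2) := by
        have : Fintype.card (Word l) ≤ 2 ^ N := by
          rw [card_vector, Fintype.card_bool]
          exact Nat.pow_le_pow_right (by norm_num) hl
        have h2 : 1 ≤ 2 ^ N := Nat.one_le_two_pow
        have h3 : 1 ≤ 2 ^ r := Nat.one_le_two_pow
        calc _ ≤ 2 ^ N * 2 ^ r + 2 ^ N * (2 ^ r + 2 ^ r) := by gcongr; nlinarith
          _ ≤ _ := by rw [pow_add, pow_add]; nlinarith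
      calc _ ≤ 2 + (2 ^ (N + r + 2)) ^ Fintype.card J := by gcongr
        _ = 2 + 2 ^ (Fintype.card J * (N + r + 2)) := by rw [← pow_mul, mul_comm (N + r + 2)]
        _ ≤ _ := by
          have : 1 ≤ 2 ^ (Fintype.card J * (N + r + 2)) := Nat.one_le_two_pow
          rw [List.length_cons, rankExponent, ← hr, pow_add _ _ 2]
          omega
    cases b with
    | true =>
      exact (HasSignedRank.isoOr (fun u => (ih' false u).mono (Nat.le_add_left _ 1)) S (e l)).mono
        ((by omega : _ ≤ _).trans hbound)
    | false =>
      exact (one.sub (HasSignedRank.isoOr (fun u => one.sub (ih' true u)) S (e l))).mono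
        ((by omega : _ ≤ _).trans hbound)

end Approx

theorem IsPolylog.rankExponent {D N : ℕ → ℕ} (hD : IsPolylog D) (hN : IsPolylog N) (k : ℕ) :
    IsPolylog fun n => rankExponent (D n) (N n) k := by
  induction k with
  | zero => exact const 2
  | succ k ih => exact (hD.mul ((hN.add ih).add (const 2))).add (const 2)

theorem HasSignedRank.ind_and {X Y : Type} (P : X → Prop) (Q : Y → Prop) :
    HasSignedRank 1 fun x y => ind (P x) * ind (Q y) :=
  of_mul _ _ (fun x => by by_cases h : P x <;> simp [ind, h])
    (fun y => by by_cases h : Q y <;> simp [ind, h])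

theorem HasSignedRank.ind_ite {X Y : Type} (c : Prop) [Decidable c] (a : X → Bool)
    (b : Y → Bool) :
    HasSignedRank (2 ^ 2) fun x y => ind (if c then a x = true ∨ b y = true
      else a x = true ∧ b y = true) := by
  have hand := ind_and (fun x => a x = true) (fun y => b y = true)
  split_ifs
  · have ha := ind_and (fun x => a x = true) (fun _ : Y => True)
    have hb := ind_and (fun _ : X => True) (fun y => b y = true)
    convert ((ha.add hb).sub hand).mono (by norm_num : 1 + 1 + 1 ≤ 2 ^ 2) using 3 with x y
    cases a x <;> cases b y <;> simp [ind]
  · convert hand.mono (by norm_num : 1 ≤ 2 ^ 2) using 3 with x y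
    cases a x <;> cases b y <;> simp [ind]

/-! ### A criterion for `BP·PP` -/

/-- The pairs `(⟨x, r⟩, ⟨y, r⟩)` for which the value `val n r x y` is positive. -/
def signLanguage (m : ℕ → ℕ) (val : (n : ℕ) → Word (m n) → Word n → Word n → ℤ) : CCLanguage :=
  {z | ∃ (n : ℕ) (x y : Word n) (r : Word (m n)), z = withRandom x y r ∧ 0 < val n r x y}

theorem length_withRandom {n m : ℕ} (x y : Word n) (r : Word m) :
    (withRandom x y r).1.1.length = 2 * n + 2 + m := by
  simp [withRandom, length_pairing]

theorem withRandom_mem_signLanguage {m : ℕ → ℕ}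
    {val : (n : ℕ) → Word (m n) → Word n → Word n → ℤ} {n : ℕ} (x y : Word n) (r : Word (m n)) :
    withRandom x y r ∈ signLanguage m val ↔ 0 < val n r x y := by
  refine ⟨?_, fun h => ⟨n, x, y, r, rfl, h⟩⟩
  rintro ⟨n', x', y', r', h, h'⟩
  simp only [withRandom, Subtype.mk.injEq, Prod.mk.injEq] at h
  obtain ⟨hx, hr⟩ := pairing_injective h.1
  obtain ⟨hy, -⟩ := pairing_injective h.2
  obtain rfl : n = n' := by simpa using congrArg List.length hx
  rwa [List.Vector.toList_injective hx, List.Vector.toList_injective hy,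
    List.Vector.toList_injective hr]

/-- Both players can decode the random string from their own input. Summing over all random strings
with the indicators of a successful decoding expresses the language by a single signed sum. -/
theorem ppComplexity_signLanguage_le {m : ℕ → ℕ} (hm : Monotone m)
    {val : (n : ℕ) → Word (m n) → Word n → Word n → ℤ} {n E : ℕ}
    (hval : ∀ r, HasSignedRank (2 ^ E) (val n r)) :
    ppComplexity ((signLanguage m val).nsection (2 * n + 2 + m n)) ≤ m n + E + 5 := by
  have hdec (X : Word (2 * n + 2 + m n)) :
      ∃ x : Word n, ∀ (x' : Word n) (r : Word (m n)),
        X.toList = pairing x'.toList r.toList → x' = x := by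
    by_cases h : ∃ (x' : Word n) (r : Word (m n)), X.toList = pairing x'.toList r.toList
    · obtain ⟨x, r, h⟩ := h
      exact ⟨x, fun x' r' h' =>
        List.Vector.toList_injective (pairing_injective (h'.symm.trans h)).1⟩
    · exact ⟨List.Vector.replicate n false, fun x' r' h' => absurd ⟨x', r', h'⟩ h⟩
  choose dec hdec using hdec
  let P (r : Word (m n)) (X : Word (2 * n + 2 + m n)) : Prop :=
    X.toList = pairing (dec X).toList r.toList
  have hrank := HasSignedRank.sum univ fun r : Word (m n) =>
    (HasSignedRank.ind_and (P r) (P r)).mul ((hval r).comp dec dec)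
  rw [card_univ, card_vector, Fintype.card_bool, one_mul, ← pow_add] at hrank
  refine hrank.ppComplexity_le fun X Y => ?_
  constructor
  · rintro ⟨n', x, y, r, h, hpos⟩
    have hlen := congrArg (fun z : EqLenPair => z.1.1.length) h
    simp only [length_withRandom, List.Vector.toList_length] at hlen
    obtain rfl : n = n' := by
      rcases lt_trichotomy n n' with hn | hn | hn
      · have := hm hn.le
        omega
      · exact hn
      · have := hm hn.le
        omega
    simp only [withRandom, Subtype.mk.injEq, Prod.mk.injEq] at h
    obtain ⟨hX, hY⟩ := h
    obtain rfl := hdec X x r hX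
    obtain rfl := hdec Y y r hY
    rw [sum_eq_single r]
    · rw [ind_of hX, ind_of hY]
      simpa using hpos
    · intro r' _ hr'
      have : ¬ P r' X := fun h' =>
        hr' (List.Vector.toList_injective (pairing_injective (h'.symm.trans hX)).2)
      rw [ind_of_not this, zero_mul, zero_mul]
    · simp
  · intro h
    obtain ⟨r, -, hr⟩ := exists_lt_of_sum_lt (f := fun _ => (0 : ℤ)) (by simpa using h)
    have hX : P r X := by
      by_contra h'
      simp [ind_of_not h'] at hr
    have hY : P r Y := by
      by_contra h'
      simp [ind_of_not h'] at hr
    rw [ind_of hX, ind_of hY, one_mul, one_mul] at hr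
    exact ⟨n, dec X, dec Y, r, Subtype.ext (Prod.ext hX hY), hr⟩

theorem signLanguage_mem_PPcc {m E : ℕ → ℕ} (hm : Monotone m) (hmp : IsPolylog m)
    (hE : IsPolylog E) {val : (n : ℕ) → Word (m n) → Word n → Word n → ℤ}
    (hval : ∀ n r, HasSignedRank (2 ^ E n) (val n r)) : signLanguage m val ∈ PPcc := by
  refine ((hmp.add hE).add (IsPolylog.const 5)).of_le_comp fun N => ?_
  by_cases h : ∃ n, N = 2 * n + 2 + m n
  · obtain ⟨n, rfl⟩ := h
    exact ⟨n, by omega, ppComplexity_signLanguage_le hm (hval n)⟩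
  · -- No input of this length encodes a random string: the section is empty.
    refine ⟨0, N.zero_le, ?_⟩
    have : ppComplexity ((signLanguage m val).nsection N) ≤ 0 + 5 := by
      refine (HasSignedRank.zero.mono (Nat.zero_le _)).ppComplexity_le fun X Y => ?_
      simp only [lt_irrefl, iff_false]
      rintro ⟨n, x, y, r, hz, -⟩
      have hlen := congrArg (fun z : EqLenPair => z.1.1.length) hz
      simp only [length_withRandom, List.Vector.toList_length] at hlen
      exact h ⟨n, hlen⟩
    omega

theorem monotone_ceil_logb (c : ℕ) :
    Monotone fun n : ℕ => ⌈(c : ℝ) * Real.logb 2 n ^ c + c⌉₊ := fun a b hab => by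
  have := logb_two_natCast_mono hab
  have := logb_two_natCast_nonneg a
  exact Nat.ceil_mono (by gcongr)

theorem isPolylog_ceil_logb (c : ℕ) :
    IsPolylog fun n : ℕ => ⌈(c : ℝ) * Real.logb 2 n ^ c + c⌉₊ := by
  have h : IsPolylog fun n : ℕ => ⌊(c : ℝ) * Real.logb 2 n ^ c + c⌋₊ :=
    ⟨c, fun n => Nat.floor_le (by have := logb_two_natCast_nonneg n; positivity)⟩
  exact (h.add (IsPolylog.const 1)).mono fun n => Nat.ceil_le_floor_add_one _

open Classical in
theorem acceptFraction_signLanguage {m : ℕ → ℕ}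
    (val : (n : ℕ) → Word (m n) → Word n → Word n → ℤ) {n : ℕ} (x y : Word n) :
    acceptFraction (signLanguage m val) (m n) x y =
      (#{r : Word (m n) | 0 < val n r x y} : ℝ) / 2 ^ m n := by
  rw [acceptFraction, ← Set.ncard_coe_finset]
  simp only [withRandom_mem_signLanguage, coe_filter, mem_univ, true_and]

open Classical in
/-- A language whose characteristic function agrees, with probability `3/4`, with a random signed sum
of quasipolynomially many rectangles is in `BP·PP`. -/
theorem mem_BP_PPcc {L : CCLanguage} {c : ℕ} {m E : ℕ → ℕ}
    (hm : ∀ n : ℕ, m n = ⌈(c : ℝ) * Real.logb 2 n ^ c + c⌉₊) (hE : IsPolylog E)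
    {val : (n : ℕ) → Word (m n) → Word n → Word n → ℤ}
    (hval : ∀ n r, HasSignedRank (2 ^ E n) (val n r))
    (hL : ∀ (n : ℕ) (x y : Word n),
      4 * #{r : Word (m n) | val n r x y ≠ ind (L.nsection n x y)} ≤ 2 ^ m n) :
    L ∈ BP PPcc := by
  obtain rfl := funext hm
  refine ⟨signLanguage _ val, signLanguage_mem_PPcc (monotone_ceil_logb c) (isPolylog_ceil_logb c)
    hE hval, fun t => c * t ^ c + c, ⟨c, fun t ht => ⟨by positivity, le_rfl⟩⟩, fun n x y => ?_⟩
  have hacc := acceptFraction_signLanguage val x y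
  specialize hL n x y
  beta_reduce at hacc hL ⊢
  rw [hacc]
  set M := ⌈(c : ℝ) * Real.logb 2 n ^ c + c⌉₊
  have hM : (0 : ℝ) < 2 ^ M := by positivity
  refine ⟨fun h => ?_, fun h => ?_⟩
  · have hA : 4 * #{r : Word M | 0 < val n r x y} ≤ 2 ^ M := by
      refine le_trans (Nat.mul_le_mul_left _ (card_le_card fun r => ?_)) hL
      simp only [mem_filter, mem_univ, true_and, ind_of_not h]
      exact fun hr => hr.ne'
    rw [div_le_iff₀ hM]
    have : (4 : ℝ) * #{r : Word M | 0 < val n r x y} ≤ 2 ^ M := by exact_mod_cast hA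
    linarith
  · have hA : 4 * #{r : Word M | ¬ 0 < val n r x y} ≤ 2 ^ M := by
      refine le_trans (Nat.mul_le_mul_left _ (card_le_card fun r => ?_)) hL
      simp only [mem_filter, mem_univ, true_and, ind_of h]
      exact fun hr hr' => hr (by rw [hr']; exact one_pos)
    have hadd := card_filter_add_card_filter_not (s := (univ : Finset (Word M)))
      (fun r => 0 < val n r x y)
    rw [card_univ, card_vector, Fintype.card_bool] at hadd
    rw [le_div_iff₀ hM]
    have h1 : (4 : ℝ) * #{r : Word M | ¬ 0 < val n r x y} ≤ 2 ^ M := by exact_mod_cast hA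
    have h2 : (#{r : Word M | 0 < val n r x y} : ℝ) + #{r : Word M | ¬ 0 < val n r x y} =
        2 ^ M := by exact_mod_cast hadd
    linarith

/-! ### The polynomial hierarchy -/

/-- A shorter random string can be extracted from a longer one. -/
theorem exists_word_projection {s m : ℕ} (h : s ≤ m) :
    ∃ π : Word m → Fin (2 ^ s), ∀ (P : Fin (2 ^ s) → Prop) [DecidablePred P],
      #{r | P (π r)} = 2 ^ (m - s) * #{ω | P ω} := by
  have e : Word m ≃ Fin (2 ^ s) × Fin (2 ^ (m - s)) := by
    refine Fintype.equivOfCardEq ?_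
    rw [card_vector, Fintype.card_bool, Fintype.card_prod, Fintype.card_fin, Fintype.card_fin,
      ← pow_add, Nat.add_sub_cancel' h]
  refine ⟨fun r => (e r).1, fun P _ => ?_⟩
  have : #(({ω | P ω} : Finset _) ×ˢ (univ : Finset (Fin (2 ^ (m - s))))) =
      2 ^ (m - s) * #{ω | P ω} := by
    rw [card_product, card_univ, Fintype.card_fin, mul_comm]
  rw [← this]
  exact card_equiv e fun r => by simp

theorem exists_word_embeddings (N : ℕ) :
    ∃ e : (l : ℕ) → Word l → Fin (2 ^ N), ∀ l ≤ N, Function.Injective (e l) := by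
  have (l : ℕ) : ∃ e : Word l → Fin (2 ^ N), l ≤ N → Function.Injective e := by
    by_cases h : l ≤ N
    · obtain ⟨e⟩ : Nonempty (Word l ↪ Fin (2 ^ N)) := by
        refine Function.Embedding.nonempty_of_card_le ?_
        rw [card_vector, Fintype.card_bool, Fintype.card_fin]
        exact Nat.pow_le_pow_right (by norm_num) h
      exact ⟨e, fun _ => e.injective⟩
    · exact ⟨fun _ => ⟨0, by positivity⟩, fun h' => absurd h' h⟩
  choose e he using this
  exact ⟨e, he⟩

open Classical in
theorem SigmaCC_subset_BP_PPcc (k : ℕ) : SigmaCC k ⊆ BP PPcc := by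
  rintro L ⟨l, hl, φ, ψ, hL⟩
  set N : ℕ → ℕ := fun n => ∑ i, l i n with hN
  have hNp : IsPolylog N := IsPolylog.sum univ hl
  have hlN (n : ℕ) : ∀ l' ∈ List.ofFn fun i => l i n, l' ≤ N n := by
    intro l' hl'
    obtain ⟨i, rfl⟩ := List.mem_ofFn.1 hl'
    exact single_le_sum (f := fun i => l i n) (fun _ _ => Nat.zero_le _) (mem_univ i)
  -- The union bound is over at most `k * 2 ^ N` prefixes.
  set p : ℕ → ℕ := fun n => N n + k + 2 with hp
  have hpp : IsPolylog p := (hNp.add (.const k)).add (.const 2)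
  obtain ⟨c, hc⟩ := ((IsPolylog.const 8).mul hpp).mul (hNp.add (.const 1))
  set m : ℕ → ℕ := fun n => ⌈(c : ℝ) * Real.logb 2 n ^ c + c⌉₊ with hm
  have hsm (n : ℕ) : 8 * p n * (N n + 1) ≤ m n := by
    have := (hc n).trans (Nat.le_ceil _)
    exact_mod_cast this
  choose π hπ using fun n => exists_word_projection (hsm n)
  choose S hS using fun n => exists_isolating_family (N n) (p n)
  choose e he using fun n => exists_word_embeddings (N n)
  let R (n : ℕ) (x y : Word n) (u : List Bool) : Prop :=
    if Even k then φ n x u = true ∨ ψ n y u = true else φ n x u = true ∧ ψ n y u = true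
  refine mem_BP_PPcc (m := m)
    (E := fun n => rankExponent (4 * p n * (N n + 1)) (N n) k)
    (val := fun n r x y => approxQuant (S n (π n r)) (e n) true (List.ofFn fun i => l i n)
      fun u => ind (R n x y u)) (fun n => rfl)
    ((((IsPolylog.const 4).mul hpp).mul (hNp.add (.const 1))).rankExponent hNp k) ?_ ?_
  · intro n r
    simpa using HasSignedRank.approxQuant (S n (π n r)) (e n) true _ (hlN n)
      (F := fun u x y => ind (R n x y u))
      fun u => HasSignedRank.ind_ite (Even k) (fun x => φ n x u) (fun y => ψ n y u)
  · intro n x y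
    have hbad := card_approxQuant_ne_le (p := p n) (S := S n) (e := e n)
      (by simpa using hS n) true (List.ofFn fun i => l i n)
      (fun l' hl' => he n l' (hlN n l' hl')) (R n x y)
    rw [hL n x y]
    have hk : k ≤ 2 ^ k := Nat.lt_two_pow_self.le
    rw [List.length_ofFn, List.sum_ofFn, Fintype.card_fin] at hbad
    rw [hπ n fun ω => approxQuant (S n ω) (e n) true (List.ofFn fun i => l i n)
      (fun u => ind (R n x y u)) ≠ ind (AltQuant true (List.ofFn fun i => l i n) (R n x y))]
    generalize #{ω | approxQuant (S n ω) (e n) true (List.ofFn fun i => l i n)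
      (fun u => ind (R n x y u)) ≠ ind (AltQuant true (List.ofFn fun i => l i n) (R n x y))} = B
      at hbad ⊢
    have h4 : 4 * B ≤ 2 ^ (8 * p n * (N n + 1)) := by
      have hpow : 2 ^ p n = 2 ^ N n * 2 ^ k * 4 := by simp only [hp, pow_add]; norm_num
      refine Nat.le_of_mul_le_mul_left (c := 2 ^ N n * 2 ^ k) ?_ (by positivity)
      calc _ = 2 ^ p n * B := by rw [hpow]; ring
        _ ≤ k * 2 ^ N n * 2 ^ (8 * p n * (N n + 1)) := hbad
        _ ≤ 2 ^ k * 2 ^ N n * 2 ^ (8 * p n * (N n + 1)) := by gcongr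
        _ = _ := by ring
    calc 4 * (2 ^ (m n - 8 * p n * (N n + 1)) * B)
        = 2 ^ (m n - 8 * p n * (N n + 1)) * (4 * B) := by ring
      _ ≤ 2 ^ (m n - 8 * p n * (N n + 1)) * 2 ^ (8 * p n * (N n + 1)) := by gcongr
      _ = 2 ^ m n := by rw [← pow_add, Nat.sub_add_cancel (hsm n)]

end CommCC

theorem mainTheorem1 : CommCC.PHcc ⊆ CommCC.BP CommCC.PPcc := by
  rintro L ⟨k, -, hL⟩
  exact CommCC.SigmaCC_subset_BP_PPcc k hL
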